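/- Let $E$ be an AL-space, i.e. a real Banach lattice with $\|f+g\|=\|f\|+\|g\|$ for all $f,g\in E_+:=\{f\in E: f\ge 0\}$. Let either $J=\mathbb N=\{1,2,\dots\}$ or $J=(0,\infty)$, and let $\mathscr T=(T_t)_{t\in J}$ be a family of bounded linear operators on $E$ with $T_{t+s}=T_tT_s$ for all $s,t\in J$ (no continuity in $t$ is required), such that $\sup_{t\in J}\|T_t\|<\infty$ and $T_tE_+\subseteq E_+$ for all $t\in J$. Suppose that for every $t\in J$ the adjoint operator $T_t'$ is a lattice homomorphism on the dual Banach lattice $E'$ (ordered by $\varphi\le\psi$ iff $\langle\varphi,f\rangle\le\langle\psi,f\rangle$ for all $f\in E_+$). Write $f>0$ if $f\ge0$ and $f\neq 0$. Then the following assertions are equivalent: (i) $\mathscr T$ is strongly convergent as $t\to\infty$, i.e. there is a bounded linear operator $P$ on $E$ with $T_tf\to Pf$ in norm for every $f\in E$, and $Pf>0$ for every $f>0$. (ii) For every $0<f\in E$ there exists a non-zero lower bound $h_f$ for $(\mathscr T,f)$, i.e. a vector $0\neq h_f\in E_+$ such that $\|(T_tf-h_f)^-\|\to0$ as $t\to\infty$.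 -/

import Mathlib

open Filter Topology

set_option linter.unusedSectionVars false

section DualLattice

variable {E : Type*} [NormedAddCommGroup E] [NormedSpace ℝ E] [Lattice E] [IsOrderedAddMonoid E]
  [IsOrderedModule ℝ E] [HasSolidNorm E]

/-- Riesz decomposition in a vector lattice. -/
theorem exists_riesz_decomposition {f g x : E} (hf : 0 ≤ f) (hg : 0 ≤ g) (hx : 0 ≤ x)
    (hxfg : x ≤ f + g) :
    ∃ y z : E, 0 ≤ y ∧ y ≤ f ∧ 0 ≤ z ∧ z ≤ g ∧ y + z = x := by
  refine ⟨x ⊓ f, x - x ⊓ f, le_inf hx hf, inf_le_right, sub_nonneg.2 inf_le_left, ?_, by abel⟩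
  rw [sub_le_comm]
  exact le_inf (by simpa using hg) (by rwa [sub_le_iff_le_add])

/-- The Riesz–Kantorovich supremum `sup {φ x | 0 ≤ x ≤ f}`, used for `f ≥ 0`. -/
noncomputable def rieszKantorovich (φ : StrongDual ℝ E) (f : E) : ℝ :=
  sSup (φ '' Set.Icc 0 f)

theorem le_norm_of_mem_Icc (φ : StrongDual ℝ E) {f x : E} (hx : x ∈ Set.Icc 0 f) :
    φ x ≤ ‖φ‖ * ‖f‖ := by
  have h1 : ‖x‖ ≤ ‖f‖ := norm_le_norm_of_abs_le_abs
    (by rw [abs_of_nonneg hx.1, abs_of_nonneg (hx.1.trans hx.2)]; exact hx.2)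
  calc φ x ≤ ‖φ x‖ := Real.le_norm_self _
    _ ≤ ‖φ‖ * ‖x‖ := φ.le_opNorm x
    _ ≤ ‖φ‖ * ‖f‖ := by gcongr

theorem le_rieszKantorovich (φ : StrongDual ℝ E) {f x : E} (h0 : 0 ≤ x) (hx : x ≤ f) :
    φ x ≤ rieszKantorovich φ f := by
  refine le_csSup ⟨‖φ‖ * ‖f‖, ?_⟩ ⟨x, ⟨h0, hx⟩, rfl⟩
  rintro _ ⟨y, hy, rfl⟩
  exact le_norm_of_mem_Icc φ hy

theorem rieszKantorovich_le (φ : StrongDual ℝ E) {f : E} (hf : 0 ≤ f) {c : ℝ}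
    (h : ∀ x, 0 ≤ x → x ≤ f → φ x ≤ c) : rieszKantorovich φ f ≤ c := by
  refine csSup_le ⟨φ 0, 0, ⟨le_rfl, hf⟩, rfl⟩ ?_
  rintro _ ⟨y, hy, rfl⟩
  exact h y hy.1 hy.2

theorem rieszKantorovich_nonneg (φ : StrongDual ℝ E) {f : E} (hf : 0 ≤ f) :
    0 ≤ rieszKantorovich φ f := by
  simpa using le_rieszKantorovich φ le_rfl hf

theorem rieszKantorovich_le_norm (φ : StrongDual ℝ E) {f : E} (hf : 0 ≤ f) :
    rieszKantorovich φ f ≤ ‖φ‖ * ‖f‖ :=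
  rieszKantorovich_le φ hf fun _ h0 hx => le_norm_of_mem_Icc φ ⟨h0, hx⟩

theorem rieszKantorovich_add (φ : StrongDual ℝ E) {f g : E} (hf : 0 ≤ f) (hg : 0 ≤ g) :
    rieszKantorovich φ (f + g) = rieszKantorovich φ f + rieszKantorovich φ g := by
  apply le_antisymm
  · refine rieszKantorovich_le φ (add_nonneg hf hg) fun x h0 hx => ?_
    obtain ⟨y, z, hy0, hy, hz0, hz, rfl⟩ := exists_riesz_decomposition hf hg h0 hx
    rw [map_add]
    exact add_le_add (le_rieszKantorovich φ hy0 hy) (le_rieszKantorovich φ hz0 hz)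
  · rw [← le_sub_iff_add_le]
    refine rieszKantorovich_le φ hf fun x hx0 hx => ?_
    rw [le_sub_comm]
    refine rieszKantorovich_le φ hg fun y hy0 hy => ?_
    rw [le_sub_iff_add_le, add_comm, ← map_add]
    exact le_rieszKantorovich φ (add_nonneg hx0 hy0) (add_le_add hx hy)

/-- The positive part `φ⁺` of a bounded functional: `φ⁺ f = sup {φ x | 0 ≤ x ≤ f}` for `f ≥ 0`,
extended linearly to `E` through `f = f⁺ - f⁻`. -/
noncomputable def dualPosPart (φ : StrongDual ℝ E) : StrongDual ℝ E :=
  let F : E →+ ℝ := AddMonoidHom.mk' (fun f => rieszKantorovich φ f⁺ - rieszKantorovich φ f⁻) (by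
    intro f g
    have h : (f + g)⁺ + (f⁻ + g⁻) = (f⁺ + g⁺) + (f + g)⁻ := by
      have h1 := posPart_sub_negPart (f + g)
      have h2 := posPart_sub_negPart f
      have h3 := posPart_sub_negPart g
      rw [← sub_eq_zero]
      have : (f + g)⁺ + (f⁻ + g⁻) - ((f⁺ + g⁺) + (f + g)⁻)
          = ((f + g)⁺ - (f + g)⁻) - (f⁺ - f⁻) - (g⁺ - g⁻) := by abel
      rw [this, h1, h2, h3]
      abel
    have h' := congrArg (rieszKantorovich φ) h
    rw [rieszKantorovich_add φ (posPart_nonneg _)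
        (add_nonneg (negPart_nonneg _) (negPart_nonneg _)),
      rieszKantorovich_add φ (negPart_nonneg _) (negPart_nonneg _),
      rieszKantorovich_add φ (add_nonneg (posPart_nonneg _) (posPart_nonneg _)) (negPart_nonneg _),
      rieszKantorovich_add φ (posPart_nonneg _) (posPart_nonneg _)] at h'
    linarith)
  F.toRealLinearMap (by
    refine AddMonoidHomClass.continuous_of_bound F ‖φ‖ fun f => ?_
    have hp : ‖f⁺‖ ≤ ‖f‖ := norm_le_norm_of_abs_le_abs
      (by rw [abs_of_nonneg (posPart_nonneg f)]; exact sup_le (le_abs_self f) (abs_nonneg f))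
    have hn : ‖f⁻‖ ≤ ‖f‖ := norm_le_norm_of_abs_le_abs
      (by rw [abs_of_nonneg (negPart_nonneg f)]; exact sup_le (neg_le_abs f) (abs_nonneg f))
    have h1 := rieszKantorovich_nonneg φ (posPart_nonneg f)
    have h2 := rieszKantorovich_nonneg φ (negPart_nonneg f)
    have h3 := rieszKantorovich_le_norm φ (posPart_nonneg f)
    have h4 := rieszKantorovich_le_norm φ (negPart_nonneg f)
    have h5 : ‖φ‖ * ‖f⁺‖ ≤ ‖φ‖ * ‖f‖ := by gcongr
    have h6 : ‖φ‖ * ‖f⁻‖ ≤ ‖φ‖ * ‖f‖ := by gcongr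
    change |rieszKantorovich φ f⁺ - rieszKantorovich φ f⁻| ≤ _
    rw [abs_le]
    constructor <;> linarith)

theorem dualPosPart_apply (φ : StrongDual ℝ E) {f : E} (hf : 0 ≤ f) :
    dualPosPart φ f = rieszKantorovich φ f := by
  have h0 : rieszKantorovich φ 0 = 0 :=
    le_antisymm (by simpa using rieszKantorovich_le_norm φ (le_refl (0 : E)))
      (rieszKantorovich_nonneg φ le_rfl)
  change rieszKantorovich φ f⁺ - rieszKantorovich φ f⁻ = _
  rw [posPart_of_nonneg hf, negPart_of_nonneg hf, h0, sub_zero]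

/-- The dual Banach lattice: `φ ≤ ψ` means `φ f ≤ ψ f` for all `f ≥ 0`, and
`φ ⊔ ψ = ψ + (φ - ψ)⁺`, `φ ⊓ ψ = φ - (φ - ψ)⁺`. -/
noncomputable abbrev dualLattice : Lattice (StrongDual ℝ E) where
  le φ ψ := ∀ f : E, 0 ≤ f → φ f ≤ ψ f
  le_refl _ _ _ := le_rfl
  le_trans _ _ _ h₁ h₂ f hf := (h₁ f hf).trans (h₂ f hf)
  le_antisymm φ ψ h₁ h₂ := by
    have h : ∀ f : E, 0 ≤ f → φ f = ψ f := fun f hf => le_antisymm (h₁ f hf) (h₂ f hf)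
    ext f
    rw [← posPart_sub_negPart f, map_sub, map_sub, h _ (posPart_nonneg f), h _ (negPart_nonneg f)]
  sup φ ψ := ψ + dualPosPart (φ - ψ)
  inf φ ψ := φ - dualPosPart (φ - ψ)
  le_sup_left φ ψ f hf := by
    have h := le_rieszKantorovich (φ - ψ) hf le_rfl
    simp only [add_apply, dualPosPart_apply _ hf]
    simp only [sub_apply] at h
    linarith
  le_sup_right φ ψ f hf := by
    have h := rieszKantorovich_nonneg (φ - ψ) hf
    simp only [add_apply, dualPosPart_apply _ hf]
    linarith
  sup_le φ ψ χ h₁ h₂ f hf := by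
    simp only [add_apply, dualPosPart_apply _ hf]
    rw [← le_sub_iff_add_le']
    refine rieszKantorovich_le _ hf fun x hx0 hx => ?_
    have h3 := h₁ x hx0
    have h4 := h₂ (f - x) (sub_nonneg.2 hx)
    simp only [sub_apply, map_sub] at h4 ⊢
    linarith
  inf_le_left φ ψ f hf := by
    have h := rieszKantorovich_nonneg (φ - ψ) hf
    simp only [sub_apply, dualPosPart_apply _ hf]
    linarith
  inf_le_right φ ψ f hf := by
    have h := le_rieszKantorovich (φ - ψ) hf le_rfl
    rw [sub_apply, dualPosPart_apply _ hf]
    simp only [sub_apply] at h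
    linarith
  le_inf φ ψ χ h₁ h₂ f hf := by
    rw [sub_apply, dualPosPart_apply _ hf, le_sub_comm]
    refine rieszKantorovich_le _ hf fun x hx0 hx => ?_
    have h3 := h₂ x hx0
    have h4 := h₁ (f - x) (sub_nonneg.2 hx)
    simp only [sub_apply, map_sub] at h4 ⊢
    linarith

/-- The adjoint `T' : E' → E'`, `T' φ = φ ∘ T`. -/
noncomputable def adjointOp (T : E →L[ℝ] E) : StrongDual ℝ E →L[ℝ] StrongDual ℝ E :=
  ContinuousLinearMap.precomp ℝ T

/-- The adjoint of `T` is a lattice homomorphism of the dual Banach lattice. -/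
def AdjointIsLatticeHom (T : E →L[ℝ] E) : Prop :=
  letI : Lattice (StrongDual ℝ E) := dualLattice
  ∀ φ ψ : StrongDual ℝ E,
    adjointOp T (φ ⊔ ψ) = adjointOp T φ ⊔ adjointOp T ψ ∧
    adjointOp T (φ ⊓ ψ) = adjointOp T φ ⊓ adjointOp T ψ

end DualLattice

section Semigroup

variable {E : Type*} [NormedAddCommGroup E] [NormedSpace ℝ E] [Lattice E]
  {J : Type*} [Add J] [Preorder J]

/-- The norm is additive on the positive cone; a Banach lattice with this property is an
AL-space. -/
def IsALNorm (E : Type*) [NormedAddCommGroup E] [Lattice E] : Prop :=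
  ∀ f g : E, 0 ≤ f → 0 ≤ g → ‖f + g‖ = ‖f‖ + ‖g‖

/-- The family `T` is a bounded positive semigroup. The index set `J` is meant to be
`{1, 2, …}` or `(0, ∞)`; no continuity in the index is required. -/
structure IsBoundedPositiveSemigroup (T : J → E →L[ℝ] E) : Prop where
  map_add : ∀ s t : J, T (t + s) = (T t).comp (T s)
  bounded : ∃ M : ℝ, ∀ t : J, ‖T t‖ ≤ M
  positive : ∀ (t : J) (f : E), 0 ≤ f → 0 ≤ T t f

/-- The vector `h` is an (individual) lower bound for `(T, f)`. -/
def IsLowerBoundFor (T : J → E →L[ℝ] E) (f h : E) : Prop :=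
  0 ≤ h ∧ Tendsto (fun t : J => ‖(T t f - h)⁻‖) atTop (𝓝 0)

/-- `T t → P` in the strong operator topology as `t → ∞`. -/
def ConvergesStronglyTo (T : J → E →L[ℝ] E) (P : E →L[ℝ] E) : Prop :=
  ∀ f : E, Tendsto (fun t : J => T t f) atTop (𝓝 (P f))

end Semigroup

/-! ### Norm convergence of monotone nets in AL-spaces and the norm functional. -/

section ALSpace

variable {E : Type*} [NormedAddCommGroup E] [Lattice E] [IsOrderedAddMonoid E]

/-! If `T t → P` strongly with `P` strictly positive on positive vectors, `P f` is itself a lower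
bound. The converse is a duality argument. Suppose some orbit diverges. Hahn–Banach, applied in the
space of bounded functions `J → E`, gives a functional that kills all convergent functions but not
this orbit. Composed with `f ↦ (T t f)_t` it yields `χ ≠ 0` which vanishes on fixed vectors and
factors as `ψ_s ∘ T s` with `ψ_s` bounded uniformly in `s` (a tail functional). So it suffices that
fixed vectors separate tail functionals (`IsTailFunctional.eq_zero`). Let `χ g > 0` with `g ≥ 0`,
let `φ` be a tail functional equal to the norm on positive fixed vectors, and put `ρ = χ - c φ` with
`c > 0` so small that `ρ g > 0`. Then `ρ⁺ ≠ 0`, and since the norm is additive on the cone, `ρ⁻ x =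
0` for some `x > 0` (`IsALNorm.exists_dualPosPart_neg_eq_zero`). The vector `x` has a fixed lower
bound `k > 0` (`exists_fixed_isLowerBoundFor`). Because the adjoints are lattice homomorphisms, `ρ⁻`
also factors through every `T s`, which forces `ρ⁻ k = 0`. Hence `ρ k ≥ 0`, contradicting `ρ k = -c
‖k‖ < 0`. -/

theorem IsALNorm.norm_sub_of_le (hE : IsALNorm E) {f g : E} (hf : 0 ≤ f) (hfg : f ≤ g) :
    ‖g - f‖ = ‖g‖ - ‖f‖ := by
  have h := hE (g - f) f (sub_nonneg.2 hfg) hf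
  rw [sub_add_cancel] at h
  linarith

theorem norm_le_norm_of_nonneg_of_le [HasSolidNorm E] {f g : E} (hf : 0 ≤ f) (hfg : f ≤ g) :
    ‖f‖ ≤ ‖g‖ :=
  norm_le_norm_of_abs_le_abs (by rwa [abs_of_nonneg hf, abs_of_nonneg (hf.trans hfg)])

theorem exists_tendsto_of_eventually_norm_sub_lt {F ι : Type*} [NormedAddCommGroup F]
    [CompleteSpace F] {l : Filter ι} [l.NeBot] {u : ι → F}
    (h : ∀ ε > 0, ∃ i, ∀ᶠ j in l, ‖u j - u i‖ < ε) : ∃ y, Tendsto u l (𝓝 y) := by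
  refine cauchy_map_iff_exists_tendsto.1 (Metric.cauchy_iff.2 ⟨inferInstance, fun ε hε => ?_⟩)
  obtain ⟨i, hi⟩ := h (ε / 2) (half_pos hε)
  refine ⟨Metric.ball (u i) (ε / 2), ?_, fun x hx y hy => ?_⟩
  · refine hi.mono fun j hj => ?_
    simpa [dist_eq_norm] using hj
  · have := dist_triangle_right x y (u i)
    rw [Metric.mem_ball] at hx hy
    linarith

/-- For comparable positive vectors distance is the difference of norms, so a term with nearly
minimal norm is close to all later ones. The order is required only eventually, which suits orbits
whose indices are compared through `t = r + s`. -/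
theorem IsALNorm.exists_tendsto_of_eventually_le [CompleteSpace E] [HasSolidNorm E]
    (hE : IsALNorm E) {ι : Type*} [Nonempty ι] {l : Filter ι} [l.NeBot] {u : ι → E}
    (h0 : ∀ i, 0 ≤ u i) (h : ∀ i, ∀ᶠ j in l, u j ≤ u i) : ∃ y, Tendsto u l (𝓝 y) := by
  refine exists_tendsto_of_eventually_norm_sub_lt fun ε hε => ?_
  have hb : BddBelow (Set.range fun i => ‖u i‖) := ⟨0, by rintro _ ⟨i, rfl⟩; exact norm_nonneg _⟩
  obtain ⟨i, hi⟩ := exists_lt_of_ciInf_lt (lt_add_of_pos_right (⨅ i, ‖u i‖) hε)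
  refine ⟨i, (h i).mono fun j hj => ?_⟩
  have := ciInf_le hb j
  rw [norm_sub_rev, hE.norm_sub_of_le (h0 j) hj]
  linarith

theorem IsALNorm.exists_tendsto_of_eventually_ge [CompleteSpace E] [HasSolidNorm E]
    (hE : IsALNorm E) {ι : Type*} [Nonempty ι] {l : Filter ι} [l.NeBot] {u : ι → E}
    (h0 : ∀ i, 0 ≤ u i) (h : ∀ i, ∀ᶠ j in l, u i ≤ u j) {C : ℝ} (hC : ∀ i, ‖u i‖ ≤ C) :
    ∃ y, Tendsto u l (𝓝 y) := by
  refine exists_tendsto_of_eventually_norm_sub_lt fun ε hε => ?_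
  have hb : BddAbove (Set.range fun i => ‖u i‖) := ⟨C, by rintro _ ⟨i, rfl⟩; exact hC i⟩
  obtain ⟨i, hi⟩ := exists_lt_of_lt_ciSup (sub_lt_self (⨆ i, ‖u i‖) hε)
  refine ⟨i, (h i).mono fun j hj => ?_⟩
  have := le_ciSup hb j
  rw [hE.norm_sub_of_le (h0 i) hj]
  linarith

theorem posPart_add_add_negPart_add_negPart (f g : E) :
    (f + g)⁺ + (f⁻ + g⁻) = (f⁺ + g⁺) + (f + g)⁻ := by
  have h1 := posPart_sub_negPart (f + g)
  have h2 := posPart_sub_negPart f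
  have h3 := posPart_sub_negPart g
  rw [← sub_eq_zero]
  have : (f + g)⁺ + (f⁻ + g⁻) - ((f⁺ + g⁺) + (f + g)⁻)
      = ((f + g)⁺ - (f + g)⁻) - (f⁺ - f⁻) - (g⁺ - g⁻) := by abel
  rw [this, h1, h2, h3]
  abel

theorem norm_posPart_le [HasSolidNorm E] (f : E) : ‖f⁺‖ ≤ ‖f‖ :=
  norm_le_norm_of_abs_le_abs
    (by rw [abs_of_nonneg (posPart_nonneg f)]; exact sup_le (le_abs_self f) (abs_nonneg f))

theorem norm_negPart_le [HasSolidNorm E] (f : E) : ‖f⁻‖ ≤ ‖f‖ :=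
  norm_le_norm_of_abs_le_abs
    (by rw [abs_of_nonneg (negPart_nonneg f)]; exact sup_le (neg_le_abs f) (abs_nonneg f))

/-- On an AL-space the norm of the positive cone extends to a bounded functional. -/
theorem IsALNorm.exists_normFunctional [NormedSpace ℝ E] [HasSolidNorm E] (hE : IsALNorm E) :
    ∃ e : StrongDual ℝ E, ∀ f, 0 ≤ f → e f = ‖f‖ := by
  let F : E →+ ℝ := AddMonoidHom.mk' (fun f => ‖f⁺‖ - ‖f⁻‖) (by
    intro f g
    have h := congrArg norm (posPart_add_add_negPart_add_negPart f g)
    rw [hE _ _ (posPart_nonneg _) (add_nonneg (negPart_nonneg _) (negPart_nonneg _)),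
      hE _ _ (negPart_nonneg _) (negPart_nonneg _),
      hE _ _ (add_nonneg (posPart_nonneg _) (posPart_nonneg _)) (negPart_nonneg _),
      hE _ _ (posPart_nonneg _) (posPart_nonneg _)] at h
    linarith)
  refine ⟨F.toRealLinearMap (AddMonoidHomClass.continuous_of_bound F 1 fun f => ?_),
    fun f hf => ?_⟩
  · have h1 := norm_posPart_le f
    have h2 := norm_negPart_le f
    change |‖f⁺‖ - ‖f⁻‖| ≤ _
    rw [abs_le]
    constructor <;> linarith [norm_nonneg f⁺, norm_nonneg f⁻]
  · change ‖f⁺‖ - ‖f⁻‖ = _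
    rw [posPart_of_nonneg hf, negPart_of_nonneg hf, norm_zero, sub_zero]

end ALSpace

/-! ### Positive and negative parts of functionals. -/

section DualPosPart

variable {E : Type*} [NormedAddCommGroup E] [NormedSpace ℝ E] [Lattice E] [IsOrderedAddMonoid E]
  [IsOrderedModule ℝ E] [HasSolidNorm E]

theorem le_dualPosPart (φ : StrongDual ℝ E) {f : E} (hf : 0 ≤ f) : φ f ≤ dualPosPart φ f := by
  rw [dualPosPart_apply φ hf]
  exact le_rieszKantorovich φ hf le_rfl

theorem dualPosPart_nonneg (φ : StrongDual ℝ E) {f : E} (hf : 0 ≤ f) : 0 ≤ dualPosPart φ f := by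
  rw [dualPosPart_apply φ hf]
  exact rieszKantorovich_nonneg φ hf

theorem dualPosPart_mono (φ : StrongDual ℝ E) {f g : E} (hfg : f ≤ g) :
    dualPosPart φ f ≤ dualPosPart φ g := by
  have := dualPosPart_nonneg φ (sub_nonneg.2 hfg)
  rw [map_sub] at this
  linarith

theorem dualPosPart_sub_dualPosPart_neg (φ : StrongDual ℝ E) {f : E} (hf : 0 ≤ f) :
    dualPosPart φ f - dualPosPart (-φ) f = φ f := by
  rw [dualPosPart_apply _ hf, dualPosPart_apply _ hf]
  apply le_antisymm
  · rw [sub_le_comm]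
    have : rieszKantorovich φ f ≤ φ f + rieszKantorovich (-φ) f :=
      rieszKantorovich_le φ hf fun x hx0 hx => by
        have := le_rieszKantorovich (-φ) (sub_nonneg.2 hx) (sub_le_self f hx0)
        simp only [neg_apply, map_sub] at this
        linarith
    linarith
  · have : rieszKantorovich (-φ) f ≤ rieszKantorovich φ f - φ f :=
      rieszKantorovich_le _ hf fun x hx0 hx => by
        have := le_rieszKantorovich φ (sub_nonneg.2 hx) (sub_le_self f hx0)
        simp only [neg_apply, map_sub] at this ⊢
        linarith
    linarith

/-- Preservation of `φ ⊔ 0 = φ⁺` is all that the argument takes from the lattice homomorphism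
property. -/
theorem AdjointIsLatticeHom.dualPosPart_comp {T : E →L[ℝ] E} (hT : AdjointIsLatticeHom T)
    (φ : StrongDual ℝ E) : dualPosPart (φ.comp T) = (dualPosPart φ).comp T := by
  have h := (hT φ 0).1
  change adjointOp T (0 + dualPosPart (φ - 0)) =
    adjointOp T 0 + dualPosPart (adjointOp T φ - adjointOp T 0) at h
  rw [map_zero, zero_add, zero_add, sub_zero, sub_zero] at h
  exact h.symm

/-- If the positive part of a functional on an AL-space is nonzero, then the negative part
vanishes at some positive vector. -/
theorem IsALNorm.exists_dualPosPart_neg_eq_zero [CompleteSpace E] (hE : IsALNorm E)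
    (φ : StrongDual ℝ E) {g : E} (hg : 0 ≤ g) (hφ : 0 < dualPosPart φ g) :
    ∃ x, 0 < x ∧ dualPosPart (-φ) x = 0 := by
  set a := dualPosPart φ with ha
  set b := dualPosPart (-φ) with hb
  have hab : ∀ x, 0 ≤ x → a x - b x = φ x := fun x hx => dualPosPart_sub_dualPosPart_neg φ hx
  -- Near-maximizers of `φ` on `[0, g]`: on them `b` is tiny and `a` is almost `a g`. The errors sum
  -- to `a g / 2`, so the infimum of all `x n` keeps at least half of `a g`.
  have happrox : ∀ n : ℕ, ∃ x, 0 ≤ x ∧ x ≤ g ∧ a g - a g / 4 * (1 / 2) ^ n ≤ φ x := by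
    intro n
    by_contra! h
    have h1 : a g ≤ a g - a g / 4 * (1 / 2) ^ n := by
      conv_lhs => rw [ha, dualPosPart_apply φ hg]
      exact rieszKantorovich_le φ hg fun x hx0 hx => (h x hx0 hx).le
    have : 0 < a g / 4 * (1 / 2) ^ n := by positivity
    linarith
  choose x hx0 hxg hx using happrox
  have hbx : ∀ n, b (x n) ≤ a g / 4 * (1 / 2) ^ n := fun n => by
    linarith [hab _ (hx0 n), hx n, dualPosPart_mono φ (hxg n)]
  have hax : ∀ n, a (g - x n) ≤ a g / 4 * (1 / 2) ^ n := fun n => by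
    rw [map_sub]
    linarith [hx n, le_dualPosPart φ (hx0 n)]
  -- `y n = x 0 ⊓ ... ⊓ x n`, a decreasing sequence, hence norm convergent.
  let y : ℕ → E := fun n => Nat.rec (x 0) (fun n z => z ⊓ x (n + 1)) n
  have hy1 : ∀ n, y (n + 1) = y n ⊓ x (n + 1) := fun _ => rfl
  have hy0 : ∀ n, 0 ≤ y n := by
    intro n
    induction n with
    | zero => exact hx0 0
    | succ n ih => rw [hy1]; exact le_inf ih (hx0 _)
  have hyx : ∀ n, y n ≤ x n := by
    intro n
    cases n with
    | zero => exact le_rfl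
    | succ n => rw [hy1]; exact inf_le_right
  have hanti : Antitone y := antitone_nat_of_succ_le fun n => by rw [hy1]; exact inf_le_left
  have hay : ∀ n, a (g - y n) ≤ a g / 2 - a g / 4 * (1 / 2) ^ n := by
    intro n
    induction n with
    | zero => have := hax 0; simp only [pow_zero, mul_one] at this ⊢; change a (g - x 0) ≤ _; linarith
    | succ n ih =>
      have h1 : g - y (n + 1) ≤ (g - y n) + (g - x (n + 1)) := by
        rw [hy1, sub_le_comm]
        refine le_inf ?_ ?_
        · have : g - (g - y n + (g - x (n + 1))) = y n - (g - x (n + 1)) := by abel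
          rw [this]
          exact sub_le_self _ (sub_nonneg.2 (hxg _))
        · have : g - (g - y n + (g - x (n + 1))) = x (n + 1) - (g - y n) := by abel
          rw [this]
          exact sub_le_self _ (sub_nonneg.2 ((hyx n).trans (hxg n)))
      have h2 := dualPosPart_mono φ h1
      rw [map_add] at h2
      have h3 := hax (n + 1)
      rw [pow_succ] at h3 ⊢
      linarith
  obtain ⟨z, hz⟩ := hE.exists_tendsto_of_eventually_le (l := atTop) hy0
    fun i => (eventually_ge_atTop i).mono fun j hj => hanti hj
  have hz0 : 0 ≤ z := ge_of_tendsto' hz hy0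
  have haz : a g / 2 ≤ a z := by
    refine ge_of_tendsto' ((a.continuous.tendsto z).comp hz) fun n => ?_
    have h1 := hay n
    rw [map_sub] at h1
    have : 0 < a g / 4 * (1 / 2) ^ n := by positivity
    simp only [Function.comp_apply]
    linarith
  refine ⟨z, lt_of_le_of_ne hz0 fun h => ?_, le_antisymm ?_ (dualPosPart_nonneg _ hz0)⟩
  · rw [← h, map_zero] at haz
    linarith
  · have h1 : Tendsto (fun n : ℕ => a g / 4 * (1 / 2 : ℝ) ^ n) atTop (𝓝 0) := by
      simpa using (tendsto_pow_atTop_nhds_zero_of_lt_one (by norm_num : (0 : ℝ) ≤ 1 / 2)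
        (by norm_num)).const_mul (a g / 4)
    refine le_of_tendsto_of_tendsto' ((b.continuous.tendsto z).comp hz) h1 fun n => ?_
    exact (dualPosPart_mono _ (hyx n)).trans (hbx n)

end DualPosPart

/-! ### Separation in spaces of bounded functions on the discrete index set. -/

section HahnBanach

open BoundedContinuousFunction

theorem Submodule.exists_strongDual_eq_zero_of_notMem {F : Type*} [NormedAddCommGroup F]
    [NormedSpace ℝ F] {V : Submodule ℝ F} (hV : IsClosed (V : Set F)) {x : F} (hx : x ∉ V) :
    ∃ Λ : StrongDual ℝ F, (∀ v ∈ V, Λ v = 0) ∧ Λ x ≠ 0 := by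
  obtain ⟨Λ, c, h1, h2⟩ := geometric_hahn_banach_point_closed V.convex hV hx
  have hc : c < 0 := by simpa using h2 0 V.zero_mem
  refine ⟨Λ, fun v hv => ?_, fun h => by linarith⟩
  by_contra h
  -- This multiple of `v` takes exactly the value `c`, which separation excludes on `V`.
  have := h2 ((c / Λ v) • v) (V.smul_mem _ hv)
  rw [map_smul, smul_eq_mul, div_mul_cancel₀ _ h] at this
  exact lt_irrefl _ this

variable {J : Type*} [TopologicalSpace J] [DiscreteTopology J]
  {E W : Type*} [NormedAddCommGroup E] [NormedSpace ℝ E] [NormedAddCommGroup W] [NormedSpace ℝ W]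

/-- A bounded family of operators, as an operator into the space of bounded functions. -/
noncomputable def boundedFamily (A : J → E →L[ℝ] W) {M : ℝ} (hA : ∀ t, ‖A t‖ ≤ M) :
    E →L[ℝ] (J →ᵇ W) :=
  LinearMap.mkContinuous
    { toFun := fun f => ofNormedAddCommGroupDiscrete (fun t => A t f) (M * ‖f‖)
        fun t => (A t).le_of_opNorm_le (hA t) f
      map_add' := fun f g => by ext t; simp
      map_smul' := fun c f => by ext t; simp }
    (max M 0) fun f => by
      refine (norm_le (by positivity)).2 fun t => ?_
      exact (A t).le_of_opNorm_le ((hA t).trans (le_max_left _ _)) f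

@[simp]
theorem boundedFamily_apply (A : J → E →L[ℝ] W) {M : ℝ} (hA : ∀ t, ‖A t‖ ≤ M) (f : E) (t : J) :
    boundedFamily A hA f t = A t f := rfl

theorem norm_boundedFamily_le (A : J → E →L[ℝ] W) {M : ℝ} (hA : ∀ t, ‖A t‖ ≤ M) :
    ‖boundedFamily A hA‖ ≤ max M 0 :=
  LinearMap.mkContinuous_norm_le _ (le_max_right _ _) _

variable (W)

/-- The bounded functions tending to zero along `l`. -/
def tendstoZeroSubmodule (l : Filter J) : Submodule ℝ (J →ᵇ W) where
  carrier := {u | Tendsto u l (𝓝 0)}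
  zero_mem' := tendsto_const_nhds
  add_mem' {u v} hu hv := by
    rw [← add_zero (0 : W)]
    exact Tendsto.add (f := u) (g := v) hu hv
  smul_mem' c u hu := by simpa using Tendsto.const_smul (f := u) hu c

/-- The bounded functions converging along `l`. -/
def convergentSubmodule (l : Filter J) : Submodule ℝ (J →ᵇ W) where
  carrier := {u | ∃ w, Tendsto u l (𝓝 w)}
  zero_mem' := ⟨0, tendsto_const_nhds⟩
  add_mem' := fun ⟨w, hu⟩ ⟨w', hv⟩ => ⟨w + w', hu.add hv⟩
  smul_mem' c _ := fun ⟨w, hu⟩ => ⟨c • w, hu.const_smul c⟩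

theorem isClosed_tendstoZeroSubmodule (l : Filter J) :
    IsClosed (tendstoZeroSubmodule W l : Set (J →ᵇ W)) := by
  refine isClosed_of_closure_subset fun u hu => ?_
  refine Metric.tendsto_nhds.2 fun ε hε => ?_
  obtain ⟨v, hv, huv⟩ := Metric.mem_closure_iff.1 hu (ε / 2) (half_pos hε)
  filter_upwards [Metric.tendsto_nhds.1 hv (ε / 2) (half_pos hε)] with t ht
  linarith [dist_triangle (u t) (v t) 0, dist_coe_le_dist (f := u) (g := v) t]

theorem isClosed_convergentSubmodule [CompleteSpace W] (l : Filter J) [l.NeBot] :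
    IsClosed (convergentSubmodule W l : Set (J →ᵇ W)) := by
  refine isClosed_of_closure_subset fun u hu => ?_
  refine cauchy_map_iff_exists_tendsto.1 (Metric.cauchy_iff.2 ⟨inferInstance, fun ε hε => ?_⟩)
  obtain ⟨v, ⟨w, hv⟩, huv⟩ := Metric.mem_closure_iff.1 hu (ε / 4) (by linarith)
  refine ⟨Metric.ball w (ε / 2), ?_, fun x hx y hy => ?_⟩
  · refine (Metric.tendsto_nhds.1 hv (ε / 4) (by linarith)).mono fun t ht => ?_
    rw [Metric.mem_ball]
    linarith [dist_triangle (u t) (v t) w, dist_coe_le_dist (f := u) (g := v) t]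
  · rw [Metric.mem_ball] at hx hy
    linarith [dist_triangle_right x y w]

end HahnBanach

/-! ### Tail functionals and lower bounds. -/

section Semigroup

variable {E : Type*} [NormedAddCommGroup E] [NormedSpace ℝ E] [Lattice E] [IsOrderedAddMonoid E]
  [IsOrderedModule ℝ E] [HasSolidNorm E] {J : Type*} [AddCommSemigroup J] [Preorder J]
  [IsDirectedOrder J] [Nonempty J]

/-- All indices are eventually translates, by arbitrarily large amounts, of a given one. -/
def EventuallyTranslate (J : Type*) [Add J] [Preorder J] : Prop :=
  ∀ s p : J, ∀ᶠ t in atTop, ∃ r, p ≤ r ∧ t = r + s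

/-- A functional is a tail functional if it factors through every `T s`, with uniformly bounded
factors. -/
def IsTailFunctional {J : Type*} (T : J → E →L[ℝ] E) (χ : StrongDual ℝ E) : Prop :=
  ∃ C : ℝ, ∀ s, ∃ ψ : StrongDual ℝ E, ‖ψ‖ ≤ C ∧ χ = ψ.comp (T s)

theorem IsTailFunctional.sub_smul {T : J → E →L[ℝ] E} {χ φ : StrongDual ℝ E}
    (hχ : IsTailFunctional T χ) (hφ : IsTailFunctional T φ) (c : ℝ) :
    IsTailFunctional T (χ - c • φ) := by
  obtain ⟨C, hC⟩ := hχ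
  obtain ⟨D, hD⟩ := hφ
  refine ⟨C + |c| * D, fun s => ?_⟩
  obtain ⟨ψ, hψ, rfl⟩ := hC s
  obtain ⟨θ, hθ, hφ⟩ := hD s
  refine ⟨ψ - c • θ, ?_, by rw [hφ]; rfl⟩
  calc ‖ψ - c • θ‖ ≤ ‖ψ‖ + ‖c • θ‖ := norm_sub_le _ _
    _ ≤ C + |c| * D := by rw [norm_smul, Real.norm_eq_abs]; gcongr

theorem IsTailFunctional.neg {T : J → E →L[ℝ] E} {χ : StrongDual ℝ E}
    (hχ : IsTailFunctional T χ) : IsTailFunctional T (-χ) := by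
  obtain ⟨C, hC⟩ := hχ
  refine ⟨C, fun s => ?_⟩
  obtain ⟨ψ, hψ, rfl⟩ := hC s
  exact ⟨-ψ, by rwa [norm_neg], rfl⟩

variable {T : J → E →L[ℝ] E}

/-- A functional that ignores null functions sees only large `t`, where `T t = T r ∘ T s` and `T s`
can be split off. -/
theorem isTailFunctional_comp_boundedFamily [TopologicalSpace J] [DiscreteTopology J]
    {W : Type*} [NormedAddCommGroup W] [NormedSpace ℝ W]
    (hJ : EventuallyTranslate J) (hT : IsBoundedPositiveSemigroup T)
    (L : E →L[ℝ] W) {M : ℝ} (hM : ∀ t, ‖L.comp (T t)‖ ≤ M)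
    (Λ : StrongDual ℝ (BoundedContinuousFunction J W))
    (hΛ : ∀ u ∈ tendstoZeroSubmodule W (atTop : Filter J), Λ u = 0) :
    IsTailFunctional T (Λ.comp (boundedFamily (fun t => L.comp (T t)) hM)) := by
  classical
  refine ⟨‖Λ‖ * max (max M 0) 0, fun s => ?_⟩
  let A : J → E →L[ℝ] W := fun t =>
    -- The value `0` is harmless: eventually every `t` is of the form `r + s`.
    if h : ∃ r, t = r + s then L.comp (T h.choose) else 0
  have hA : ∀ t, ‖A t‖ ≤ max M 0 := fun t => by
    by_cases h : ∃ r, t = r + s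
    · simp only [A, dif_pos h]
      exact (hM _).trans (le_max_left _ _)
    · simp [A, dif_neg h]
  refine ⟨Λ.comp (boundedFamily A hA), ?_, ?_⟩
  · exact (ContinuousLinearMap.opNorm_comp_le _ _).trans
      (mul_le_mul_of_nonneg_left (norm_boundedFamily_le A hA) (norm_nonneg _))
  · ext f
    rw [← sub_eq_zero]
    simp only [ContinuousLinearMap.comp_apply]
    rw [← map_sub]
    refine hΛ _ (tendsto_const_nhds.congr' ?_)
    filter_upwards [hJ s s] with t ⟨r, _, hr⟩
    have h : ∃ r, t = r + s := ⟨r, hr⟩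
    have h' : T t f = T h.choose (T s f) := by
      conv_lhs => rw [h.choose_spec, hT.map_add]
      rfl
    simp [A, dif_pos h, h']

theorem IsBoundedPositiveSemigroup.mono (hT : IsBoundedPositiveSemigroup T) (t : J) {f g : E}
    (h : f ≤ g) : T t f ≤ T t g := by
  have := hT.positive t _ (sub_nonneg.2 h)
  rwa [map_sub, sub_nonneg] at this

theorem IsBoundedPositiveSemigroup.comm (hT : IsBoundedPositiveSemigroup T) (s t : J) (f : E) :
    T s (T t f) = T t (T s f) := by
  have h1 := congrArg (fun S : E →L[ℝ] E => S f) (hT.map_add t s)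
  have h2 := congrArg (fun S : E →L[ℝ] E => S f) (hT.map_add s t)
  rw [add_comm] at h1
  exact h1.symm.trans h2

theorem le_negPart_sub_add (f h : E) : h ≤ (f - h)⁻ + f := by
  have := neg_le_negPart (f - h)
  rw [neg_sub] at this
  exact sub_le_iff_le_add.1 this

/-- `(T t f - h ⊔ k)⁻ ≤ (T t f - h)⁻ + (T t f - k)⁻`. -/
theorem IsLowerBoundFor.sup {f h k : E} (hh : IsLowerBoundFor T f h) (hk : IsLowerBoundFor T f k) :
    IsLowerBoundFor T f (h ⊔ k) := by
  refine ⟨hh.1.trans le_sup_left, ?_⟩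
  refine squeeze_zero (fun _ => norm_nonneg _) (fun t => ?_) (by simpa using hh.2.add hk.2)
  refine (norm_le_norm_of_nonneg_of_le (negPart_nonneg _) ?_).trans (norm_add_le _ _)
  have h1 := negPart_nonneg (T t f - h)
  have h2 := negPart_nonneg (T t f - k)
  rw [negPart_def, neg_sub]
  refine sup_le (sub_le_iff_le_add.2 (sup_le ?_ ?_)) (add_nonneg h1 h2)
  · refine (le_negPart_sub_add (T t f) h).trans ?_
    gcongr
    exact le_add_of_nonneg_right h2
  · refine (le_negPart_sub_add (T t f) k).trans ?_
    gcongr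
    exact le_add_of_nonneg_left h1

theorem EventuallyTranslate.eventually (hJ : EventuallyTranslate J) {p : J → Prop}
    (hp : ∀ᶠ r in atTop, p r) (s : J) : ∀ᶠ t in atTop, ∃ r, p r ∧ t = r + s := by
  obtain ⟨r₀, hr₀⟩ := eventually_atTop.1 hp
  filter_upwards [hJ s r₀] with t ⟨r, hr, ht⟩
  exact ⟨r, hr₀ r hr, ht⟩

theorem IsBoundedPositiveSemigroup.map_add_apply (hT : IsBoundedPositiveSemigroup T) (r s : J)
    (f : E) : T (r + s) f = T s (T r f) := by
  rw [hT.map_add, hT.comm s r]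
  rfl

/-- `(T (r + s) f - T s h)⁻ ≤ T s (T r f - h)⁻` by positivity. -/
theorem IsLowerBoundFor.map (hJ : EventuallyTranslate J) (hT : IsBoundedPositiveSemigroup T)
    {f h : E} (hh : IsLowerBoundFor T f h) (s : J) : IsLowerBoundFor T f (T s h) := by
  refine ⟨hT.positive s h hh.1, Metric.tendsto_nhds.2 fun ε hε => ?_⟩
  have h1 := hh.2.const_mul ‖T s‖
  rw [mul_zero] at h1
  filter_upwards [hJ.eventually (Metric.tendsto_nhds.1 h1 ε hε) s] with t ⟨r, hr, ht⟩
  rw [Real.dist_0_eq_abs] at hr ⊢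
  rw [abs_norm, ht, hT.map_add_apply]
  refine lt_of_le_of_lt ?_ ((le_abs_self _).trans_lt hr)
  refine (norm_le_norm_of_nonneg_of_le (negPart_nonneg _) ?_).trans ((T s).le_opNorm _)
  rw [negPart_def]
  refine sup_le ?_ (hT.positive _ _ (negPart_nonneg _))
  rw [← map_sub, ← map_neg]
  exact hT.mono s (neg_le_negPart _)

theorem IsLowerBoundFor.norm_le {M : ℝ} (hM : ∀ t, ‖T t‖ ≤ M)
    {f h : E} (hh : IsLowerBoundFor T f h) : ‖h‖ ≤ M * ‖f‖ := by
  refine ge_of_tendsto' (b := ‖h‖) (f := fun t => ‖(T t f - h)⁻‖ + M * ‖f‖) (x := atTop)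
    (by simpa using hh.2.add_const (M * ‖f‖)) fun t => ?_
  have h1 : |h| ≤ |((T t f - h)⁻ + |T t f|)| := by
    rw [abs_of_nonneg hh.1, abs_of_nonneg (add_nonneg (negPart_nonneg _) (abs_nonneg _))]
    refine (le_negPart_sub_add (T t f) h).trans ?_
    gcongr
    exact le_abs_self _
  refine (norm_le_norm_of_abs_le_abs h1).trans ((norm_add_le _ _).trans ?_)
  rw [norm_abs_eq_norm]
  gcongr
  exact (T t).le_of_opNorm_le (hM t) f

theorem IsLowerBoundFor.of_tendsto {f y : E} {ι : Type*} {l : Filter ι} [l.NeBot] {u : ι → E}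
    (hu : Tendsto u l (𝓝 y)) (h : ∀ i, IsLowerBoundFor T f (u i)) : IsLowerBoundFor T f y := by
  refine ⟨ge_of_tendsto' hu fun i => (h i).1, Metric.tendsto_nhds.2 fun ε hε => ?_⟩
  obtain ⟨i, hi⟩ := (Metric.tendsto_nhds.1 hu (ε / 2) (half_pos hε)).exists
  filter_upwards [Metric.tendsto_nhds.1 (h i).2 (ε / 2) (half_pos hε)] with t ht
  have h1 := (lipschitzWith_negPart (α := E)).dist_le_mul (T t f - y) (T t f - u i)
  rw [NNReal.coe_one, one_mul, dist_sub_left, dist_comm y] at h1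
  rw [Real.dist_0_eq_abs, abs_norm] at ht ⊢
  have h2 := dist_triangle (T t f - y)⁻ (T t f - u i)⁻ 0
  rw [dist_zero_right, dist_zero_right] at h2
  linarith

/-- If every positive vector has a nonzero lower bound, it has one which is a fixed vector. -/
theorem exists_fixed_isLowerBoundFor [CompleteSpace E] (hE : IsALNorm E)
    (hJ : EventuallyTranslate J) (hT : IsBoundedPositiveSemigroup T)
    (hlb : ∀ f : E, 0 < f → ∃ h : E, h ≠ 0 ∧ IsLowerBoundFor T f h) {f : E} (hf : 0 < f) :
    ∃ k, 0 < k ∧ (∀ t, T t k = k) ∧ IsLowerBoundFor T f k := by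
  obtain ⟨M, hM⟩ := hT.bounded
  obtain ⟨h₀, hh₀, hh₀f⟩ := hlb f hf
  let L := {h : E // IsLowerBoundFor T f h}
  have : Nonempty L := ⟨⟨h₀, hh₀f⟩⟩
  have : IsDirectedOrder L := ⟨fun a b =>
    ⟨⟨a.1 ⊔ b.1, a.2.sup b.2⟩, le_sup_left (a := a.1), le_sup_right (b := b.1)⟩⟩
  -- The lower bounds are directed upwards and norm bounded, so they converge to a greatest one,
  -- `m`. As each `T r m` is again a lower bound, `T r m ≤ m`, and the orbit of `m` decreases to a
  -- fixed vector `k`.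
  obtain ⟨m, hm⟩ := hE.exists_tendsto_of_eventually_ge (l := (atTop : Filter L))
    (u := fun h => h.1) (fun h => h.2.1) (fun h => eventually_ge_atTop h)
    fun h => h.2.norm_le hM
  have hmf : IsLowerBoundFor T f m := .of_tendsto hm fun h => h.2
  have hmax : ∀ h, IsLowerBoundFor T f h → h ≤ m := fun h hh =>
    ge_of_tendsto hm (eventually_ge_atTop (⟨h, hh⟩ : L))
  have hm0 : 0 < m := lt_of_le_of_ne hmf.1 fun h =>
    hh₀ (le_antisymm (h ▸ hmax h₀ hh₀f) hh₀f.1)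
  obtain ⟨k, hk⟩ := hE.exists_tendsto_of_eventually_le (l := (atTop : Filter J))
    (u := fun t => T t m) (fun t => hT.positive t m hmf.1) fun s => by
      filter_upwards [hJ s s] with t ⟨r, _, ht⟩
      rw [ht, hT.map_add_apply]
      exact hT.mono s (hmax _ (hmf.map hJ hT r))
  have hkf : IsLowerBoundFor T f k := .of_tendsto hk fun t => hmf.map hJ hT t
  refine ⟨k, lt_of_le_of_ne hkf.1 fun h => ?_, fun s => ?_, hkf⟩
  -- If `T t m → 0`, a lower bound `g` for `m` satisfies `‖g‖ = ‖(0 - g)⁻‖ = 0`.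
  · obtain ⟨g, hg, hgm⟩ := hlb m hm0
    rw [← h] at hk
    have h1 : Tendsto (fun t => ‖(T t m - g)⁻‖) atTop (𝓝 ‖(0 - g)⁻‖) :=
      ((continuous_negPart.tendsto _).comp (hk.sub_const g)).norm
    have h2 := tendsto_nhds_unique h1 hgm.2
    rw [zero_sub, negPart_neg, posPart_of_nonneg hgm.1, norm_eq_zero] at h2
    exact hg h2
  · refine tendsto_nhds_unique (Metric.tendsto_nhds.2 fun ε hε => ?_) hk
    have h1 := ((T s).continuous.tendsto k).comp hk
    filter_upwards [hJ.eventually (Metric.tendsto_nhds.1 h1 ε hε) s] with t ⟨r, hr, ht⟩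
    rwa [ht, hT.map_add_apply]

end Semigroup

/-! ### Fixed vectors separate tail functionals; strong convergence. -/

section Convergence

variable {E : Type*} [NormedAddCommGroup E] [NormedSpace ℝ E] [Lattice E] [IsOrderedAddMonoid E]
  [IsOrderedModule ℝ E] [HasSolidNorm E] {J : Type*} [AddCommSemigroup J] [Preorder J]
  [IsDirectedOrder J] [Nonempty J] {T : J → E →L[ℝ] E}

/-- Some tail functional coincides with the norm on the positive fixed vectors. -/
theorem exists_isTailFunctional_eq_norm (hE : IsALNorm E) (hJ : EventuallyTranslate J)
    (hT : IsBoundedPositiveSemigroup T) :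
    ∃ φ, IsTailFunctional T φ ∧ ∀ k, 0 ≤ k → (∀ t, T t k = k) → φ k = ‖k‖ := by
  let _ : TopologicalSpace J := ⊥
  have : DiscreteTopology J := ⟨rfl⟩
  obtain ⟨M, hM⟩ := hT.bounded
  obtain ⟨e, he⟩ := hE.exists_normFunctional
  have hM' : ∀ t, ‖e.comp (T t)‖ ≤ ‖e‖ * M := fun t =>
    (e.opNorm_comp_le (T t)).trans (mul_le_mul_of_nonneg_left (hM t) (norm_nonneg _))
  obtain ⟨Λ, hΛ, hΛ1⟩ :=
    (tendstoZeroSubmodule ℝ (atTop : Filter J)).exists_strongDual_eq_zero_of_notMem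
    (isClosed_tendstoZeroSubmodule ℝ _) (x := BoundedContinuousFunction.const J (1 : ℝ))
    fun h => one_ne_zero (tendsto_nhds_unique tendsto_const_nhds h)
  -- A generalized limit, normalized at the constant `1`, of `e (T t f)`; its positivity is not
  -- needed.
  refine ⟨_, isTailFunctional_comp_boundedFamily hJ hT e hM'
    ((Λ (BoundedContinuousFunction.const J 1))⁻¹ • Λ) fun u hu => ?_, fun k hk0 hk => ?_⟩
  · simp [hΛ u hu]
  · have h1 : boundedFamily (fun t => e.comp (T t)) hM' k
        = ‖k‖ • BoundedContinuousFunction.const J (1 : ℝ) := by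
      ext t
      simp [hk, he k hk0]
    rw [ContinuousLinearMap.comp_apply, h1, map_smul, smul_eq_mul, smul_apply,
      smul_eq_mul, inv_mul_cancel₀ hΛ1, mul_one]

/-- With `ρ = ψ ∘ T s` also `ρ⁺ = ψ⁺ ∘ T s`, so `k ≤ (T s f - k)⁻ + T s f` gives `ρ⁺ k = ψ⁺ k ≤ C
‖(T s f - k)⁻‖ + ρ⁺ f`. The last term is zero; uniformity of `C` in `s` lets the other tend to zero.
-/
theorem IsTailFunctional.dualPosPart_le_zero {ρ : StrongDual ℝ E} (hρ : IsTailFunctional T ρ)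
    (hT' : ∀ t, AdjointIsLatticeHom (T t)) {f k : E} (hfρ : dualPosPart ρ f = 0)
    (hk : ∀ t, T t k = k) (hfk : IsLowerBoundFor T f k) : dualPosPart ρ k ≤ 0 := by
  obtain ⟨C, hC⟩ := hρ
  have h1 := hfk.2.const_mul C
  rw [mul_zero] at h1
  refine ge_of_tendsto' h1 fun s => ?_
  obtain ⟨ψ, hψ, rfl⟩ := hC s
  rw [(hT' s).dualPosPart_comp, ContinuousLinearMap.comp_apply] at hfρ ⊢
  rw [hk]
  have h2 := dualPosPart_mono ψ (le_negPart_sub_add (T s f) k)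
  rw [map_add, hfρ, add_zero] at h2
  refine h2.trans ?_
  rw [dualPosPart_apply _ (negPart_nonneg _)]
  exact (rieszKantorovich_le_norm ψ (negPart_nonneg _)).trans
    (mul_le_mul_of_nonneg_right hψ (norm_nonneg _))

theorem IsTailFunctional.apply_le_zero [CompleteSpace E] (hE : IsALNorm E)
    (hJ : EventuallyTranslate J) (hT : IsBoundedPositiveSemigroup T)
    (hT' : ∀ t, AdjointIsLatticeHom (T t))
    (hlb : ∀ f : E, 0 < f → ∃ h : E, h ≠ 0 ∧ IsLowerBoundFor T f h)
    {χ : StrongDual ℝ E} (hχ : IsTailFunctional T χ) (hfix : ∀ k, (∀ t, T t k = k) → χ k = 0)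
    {g : E} (hg : 0 ≤ g) : χ g ≤ 0 := by
  obtain ⟨φ, hφ, hφk⟩ := exists_isTailFunctional_eq_norm hE hJ hT
  by_contra! hχg
  obtain ⟨c, hc, hcg⟩ : ∃ c : ℝ, 0 < c ∧ c * φ g < χ g := by
    -- This choice covers every sign of `φ g`, including `φ g = 0`.
    refine ⟨χ g / (2 * (|φ g| + 1)), by positivity, ?_⟩
    rw [div_mul_eq_mul_div, div_lt_iff₀ (by positivity)]
    nlinarith [le_abs_self (φ g), abs_nonneg (φ g)]
  have hρ := hχ.sub_smul hφ c
  obtain ⟨x, hx, hxρ⟩ := hE.exists_dualPosPart_neg_eq_zero (χ - c • φ) hg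
    ((sub_pos.2 hcg).trans_le (le_dualPosPart (χ - c • φ) hg))
  obtain ⟨k, hk0, hk, hxk⟩ := exists_fixed_isLowerBoundFor hE hJ hT hlb hx
  have h1 := hρ.neg.dualPosPart_le_zero hT' hxρ hk hxk
  have h2 := dualPosPart_sub_dualPosPart_neg (χ - c • φ) hk0.le
  have h3 := dualPosPart_nonneg (χ - c • φ) hk0.le
  have h4 : (χ - c • φ) k = -(c * ‖k‖) := by
    simp [hfix k hk, hφk k hk0.le hk]
  have h5 : 0 < c * ‖k‖ := mul_pos hc (norm_pos_iff.2 hk0.ne')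
  linarith

/-- The fixed vectors separate the tail functionals. -/
theorem IsTailFunctional.eq_zero [CompleteSpace E] (hE : IsALNorm E)
    (hJ : EventuallyTranslate J) (hT : IsBoundedPositiveSemigroup T)
    (hT' : ∀ t, AdjointIsLatticeHom (T t))
    (hlb : ∀ f : E, 0 < f → ∃ h : E, h ≠ 0 ∧ IsLowerBoundFor T f h)
    {χ : StrongDual ℝ E} (hχ : IsTailFunctional T χ) (hfix : ∀ k, (∀ t, T t k = k) → χ k = 0) :
    χ = 0 := by
  have h : ∀ g, 0 ≤ g → χ g = 0 := fun g hg => by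
    refine le_antisymm (hχ.apply_le_zero hE hJ hT hT' hlb hfix hg) ?_
    have := hχ.neg.apply_le_zero hE hJ hT hT' hlb (fun k hk => by simp [hfix k hk]) hg
    simpa using this
  ext f
  rw [← posPart_sub_negPart f, map_sub, h _ (posPart_nonneg f), h _ (negPart_nonneg f)]
  simp

theorem exists_tendsto_of_isLowerBoundFor [CompleteSpace E] (hE : IsALNorm E)
    (hJ : EventuallyTranslate J) (hT : IsBoundedPositiveSemigroup T)
    (hT' : ∀ t, AdjointIsLatticeHom (T t))
    (hlb : ∀ f : E, 0 < f → ∃ h : E, h ≠ 0 ∧ IsLowerBoundFor T f h) (f : E) :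
    ∃ y, Tendsto (fun t => T t f) atTop (𝓝 y) := by
  let _ : TopologicalSpace J := ⊥
  have : DiscreteTopology J := ⟨rfl⟩
  obtain ⟨M, hM⟩ := hT.bounded
  have hM' : ∀ t, ‖(ContinuousLinearMap.id ℝ E).comp (T t)‖ ≤ M := hM
  set S := boundedFamily (fun t => (ContinuousLinearMap.id ℝ E).comp (T t)) hM' with hS
  by_contra hf
  obtain ⟨Λ, hΛ, hΛf⟩ :=
    (convergentSubmodule E (atTop : Filter J)).exists_strongDual_eq_zero_of_notMem
    (isClosed_convergentSubmodule E _) (x := S f) hf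
  have hχ : IsTailFunctional T (Λ.comp S) := isTailFunctional_comp_boundedFamily hJ hT _ hM' Λ
    fun u hu => hΛ u ⟨0, hu⟩
  have h0 := hχ.eq_zero hE hJ hT hT' hlb fun k hk =>
    hΛ _ ⟨k, tendsto_const_nhds.congr fun t => (hk t).symm⟩
  exact hΛf (congrArg (fun χ : StrongDual ℝ E => χ f) h0)

/-- A pointwise convergent bounded family of operators converges strongly to an operator. -/
theorem exists_convergesStronglyTo (hT : ∃ M : ℝ, ∀ t, ‖T t‖ ≤ M)
    (h : ∀ f, ∃ y, Tendsto (fun t => T t f) atTop (𝓝 y)) :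
    ∃ P : E →L[ℝ] E, ConvergesStronglyTo T P := by
  obtain ⟨M, hM⟩ := hT
  choose P hP using h
  refine ⟨LinearMap.mkContinuous
    { toFun := P
      map_add' := fun f g => tendsto_nhds_unique (hP (f + g)) (by simpa using (hP f).add (hP g))
      map_smul' := fun c f => tendsto_nhds_unique (hP (c • f))
        (by simpa using (hP f).const_smul c) } M fun f => ?_, hP⟩
  exact le_of_tendsto' (hP f).norm fun t => (T t).le_of_opNorm_le (hM t) f

theorem exists_convergesStronglyTo_iff_exists_isLowerBoundFor [CompleteSpace E] (hE : IsALNorm E)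
    (hJ : EventuallyTranslate J) (hT : IsBoundedPositiveSemigroup T)
    (hT' : ∀ t, AdjointIsLatticeHom (T t)) :
    (∃ P : E →L[ℝ] E, ConvergesStronglyTo T P ∧ ∀ f : E, 0 < f → 0 < P f) ↔
      ∀ f : E, 0 < f → ∃ h : E, h ≠ 0 ∧ IsLowerBoundFor T f h := by
  constructor
  · rintro ⟨P, hP, hpos⟩ f hf
    refine ⟨P f, (hpos f hf).ne', (hpos f hf).le, ?_⟩
    have h1 := ((hP f).sub_const (P f)).norm
    rw [sub_self, norm_zero] at h1
    exact squeeze_zero (fun _ => norm_nonneg _) (fun t => norm_negPart_le _) h1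
  · intro hlb
    obtain ⟨P, hP⟩ := exists_convergesStronglyTo hT.bounded
      (exists_tendsto_of_isLowerBoundFor hE hJ hT hT' hlb)
    refine ⟨P, hP, fun f hf => ?_⟩
    refine lt_of_le_of_ne (ge_of_tendsto' (hP f) fun t => hT.positive t f hf.le) fun h => ?_
    obtain ⟨g, hg, hgf⟩ := hlb f hf
    have h1 := ((continuous_negPart.tendsto _).comp ((hP f).sub_const g)).norm
    have h2 := tendsto_nhds_unique h1 hgf.2
    rw [← h, zero_sub, negPart_neg, posPart_of_nonneg hgf.1, norm_eq_zero] at h2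
    exact hg h2

end Convergence

/-! ### The two index sets. -/

theorem eventuallyTranslate_pnat : EventuallyTranslate ℕ+ := fun s p => by
  filter_upwards [eventually_ge_atTop (p + s)] with t ht
  -- Strictness matters: subtraction in `ℕ+` truncates at `1`.
  have hs : s < t := (PNat.lt_add_left s p).trans_le ht
  have h : t - s + s = t := PNat.sub_add_of_lt hs
  exact ⟨t - s, le_of_add_le_add_right (h.symm ▸ ht), h.symm⟩

theorem eventuallyTranslate_pos_real : EventuallyTranslate {t : ℝ // 0 < t} := fun s p => by
  filter_upwards [eventually_ge_atTop (p + s)] with t ht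
  have h : p.1 + s.1 ≤ t.1 := ht
  refine ⟨⟨t.1 - s.1, by linarith [p.2]⟩, ?_, Subtype.ext ?_⟩
  · change p.1 ≤ t.1 - s.1
    linarith
  · change t.1 = t.1 - s.1 + s.1
    ring

theorem theorem5p1 {E : Type*} [NormedAddCommGroup E] [NormedSpace ℝ E] [CompleteSpace E]
    [Lattice E] [IsOrderedAddMonoid E] [IsOrderedModule ℝ E] [HasSolidNorm E]
    (hE : IsALNorm E) :
    (∀ T : ℕ+ → E →L[ℝ] E, IsBoundedPositiveSemigroup T → (∀ t, AdjointIsLatticeHom (T t)) →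
      ((∃ P : E →L[ℝ] E, ConvergesStronglyTo T P ∧ ∀ f : E, 0 < f → 0 < P f) ↔
        ∀ f : E, 0 < f → ∃ h : E, h ≠ 0 ∧ IsLowerBoundFor T f h)) ∧
    (∀ T : {t : ℝ // 0 < t} → E →L[ℝ] E, IsBoundedPositiveSemigroup T →
      (∀ t, AdjointIsLatticeHom (T t)) →
      ((∃ P : E →L[ℝ] E, ConvergesStronglyTo T P ∧ ∀ f : E, 0 < f → 0 < P f) ↔
        ∀ f : E, 0 < f → ∃ h : E, h ≠ 0 ∧ IsLowerBoundFor T f h)) := by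
  have : Nonempty {t : ℝ // 0 < t} := ⟨⟨1, one_pos⟩⟩
  exact ⟨fun _ hT hT' => exists_convergesStronglyTo_iff_exists_isLowerBoundFor hE
      eventuallyTranslate_pnat hT hT',
    fun _ hT hT' => exists_convergesStronglyTo_iff_exists_isLowerBoundFor hE
      eventuallyTranslate_pos_real hT hT'⟩
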